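/- Let $\lambda$ be a partition. A filling of the Young diagram of $\lambda$ assigns positive integers, possibly repeated, to its boxes so that no positive integer is skipped; it has content $\mu$ if it contains exactly $\mu_k$ entries equal to $k$ for every $k$. Let $I(\lambda,\mu)$ be the set of fillings of shape $\lambda$ and content $\mu$ whose entries strictly increase from left to right along each row (inverted semistandard Young tableaux). Such a tableau is semistandard if moreover its entries weakly increase from top to bottom down each column. For $\tau\in I(\lambda,\mu)$, the standardization $\mathrm{st}(\tau)$ is the unique semistandard Young tableau obtained by independently reordering the columns of $\tau$. For entries $a,b$ in two boxes of the same column of $\tau$, let $a_k,b_k$ be the entries exactly $k$ boxes to their right. The pair $(a,b)$ is an inversion pair if $a<b$ and, for some $n\ge 0$, $a_k,b_k$ exist and $a_k=b_k$ for all $1\le k\le n$, and either (i) $a_{n+1}$ or $b_{n+1}$ does not exist and $a$ lies below $b$, or (ii) $a_{n+1},b_{n+1}$ exist and $a_{n+1}>b_{n+1}$. Let $\mathrm{inv}(\tau)$ be the number of inversion pairs, where different pairs of boxes are counted separately. The height order $\blacktriangleleft$ on each column of $\tau$ is the total order defined from the rightmost column leftward as follows. For distinct boxes of the column with entries $a,a'$: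 if at least one of them has no box directly to its right, then $a\blacktriangleleft a'$ when $a$ lies above $a'$; if $b,b'$ are the entries directly to the right of $a,a'$, then $a\blacktriangleleft a'$ when $b<b'$, or when $b=b'$ in value and $b\blacktriangleleft b'$. The entry that is $k$-th smallest of its column in this order has height $k$. Given entries $a<a'$ in rows $i,i'$ of column $j$ whose heights differ by exactly $1$, the partial row transposition at $(a,a')$ interchanges rows $i$ and $i'$ in columns $1,\dots,j$ and leaves all other boxes unchanged. It is admissible if $a$ and $a'$ are both smaller than each of those entries directly to the right of $a$ and of $a'$ that exist. Proposition. Let $\tau\in I(\lambda,\mu)$ and $T=\mathrm{st}(\tau)$. Then $\tau$ can be obtained from $T$ by a finite (possibly empty) sequence of admissible partial row transpositions, and the minimum number of transpositions in such a sequence is $\mathrm{inv}(\tau)$. -/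

import Mathlib

/-- A filling of a Young diagram: an assignment of positive integers to the boxes such that no
positive integer is skipped.  Rows and columns are indexed from `0`; row `0` is the top row and
column `0` is the leftmost column.  Following Mathlib's convention for tableaux, `entry` takes the
value `0` off the diagram. -/
@[ext]
structure YoungFilling (Y : YoungDiagram) where
  entry : ℕ → ℕ → ℕ
  zeros : ∀ i j, (i, j) ∉ Y → entry i j = 0
  pos : ∀ i j, (i, j) ∈ Y → 0 < entry i j
  no_skip : ∀ i j k, (i, j) ∈ Y → 0 < k → k ≤ entry i j →
    ∃ i' j', (i', j') ∈ Y ∧ entry i' j' = k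

/-- An inverted (semistandard) Young tableau: a row-standard filling, i.e. the entries increase
strictly from left to right along each row. -/
@[ext]
structure InvertedTableau (Y : YoungDiagram) extends YoungFilling Y where
  row_lt : ∀ i j₁ j₂, j₁ < j₂ → (i, j₂) ∈ Y → entry i j₁ < entry i j₂

namespace InvertedTableau

variable {Y : YoungDiagram}

/-- The number of boxes with entry `k`. -/
def content (τ : InvertedTableau Y) (k : ℕ) : ℕ :=
  (Y.cells.filter fun c => τ.entry c.1 c.2 = k).card

/-- The multiset of entries of the `j`-th column. -/
def column (τ : InvertedTableau Y) (j : ℕ) : Multiset ℕ :=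
  (Multiset.range (Y.colLen j)).map fun i => τ.entry i j

/-- Column-semistandard: the entries increase weakly from top to bottom down each column.  (A
row-standard filling with this property is a semistandard Young tableau.) -/
def ColumnSemistandard (τ : InvertedTableau Y) : Prop :=
  ∀ i₁ i₂ j, i₁ < i₂ → (i₂, j) ∈ Y → τ.entry i₁ j ≤ τ.entry i₂ j

/-- `T` is a semistandard Young tableau obtained by independently reordering the columns of `τ`. -/
def IsStandardization (τ T : InvertedTableau Y) : Prop :=
  T.ColumnSemistandard ∧ ∀ j, T.column j = τ.column j

/-- The columns of an inverted tableau can be independently reordered so as to give a semistandard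
Young tableau, and the latter is unique. -/
theorem existsUnique_standardization (τ : InvertedTableau Y) :
    ∃! T : InvertedTableau Y, τ.IsStandardization T := by
  classical
  let f : (j : ℕ) → Fin (Y.colLen j) → ℕ := fun j i => τ.entry i j
  let s : (j : ℕ) → Equiv.Perm (Fin (Y.colLen j)) := fun j => Tuple.sort (f j)
  have hmono : ∀ j, Monotone (f j ∘ s j) := fun j => Tuple.monotone_sort (f j)
  let e : ℕ → ℕ → ℕ := fun i j => if h : i < Y.colLen j then f j (s j ⟨i, h⟩) else 0
  have he : ∀ j (i : Fin (Y.colLen j)), e i j = f j (s j i) := fun j i => by simp [e]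
  have hmem : ∀ i j, (i, j) ∈ Y ↔ i < Y.colLen j := fun i j => YoungDiagram.mem_iff_lt_colLen
  have hrow : ∀ i j₁ j₂, j₁ < j₂ → (i, j₂) ∈ Y → e i j₁ < e i j₂ := by
    intro i j₁ j₂ hj hi
    have h2 : i < Y.colLen j₂ := (hmem _ _).1 hi
    have hle : Y.colLen j₂ ≤ Y.colLen j₁ := Y.colLen_anti _ _ hj.le
    have h1 : i < Y.colLen j₁ := h2.trans_le hle
    by_contra hcon
    rw [not_lt] at hcon
    have hlt : ∀ k : Fin (i + 1), (((s j₁).symm (Fin.castLE hle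
        (s j₂ ⟨k, (Nat.lt_succ_iff.1 k.2).trans_lt h2⟩)) : Fin _) : ℕ) < i := by
      intro k
      by_contra hk
      rw [not_lt] at hk
      set r := s j₂ ⟨k, (Nat.lt_succ_iff.1 k.2).trans_lt h2⟩ with hr
      have a1 : e i j₁ ≤ f j₁ (Fin.castLE hle r) := by
        have := hmono j₁ (show (⟨i, h1⟩ : Fin _) ≤ (s j₁).symm (Fin.castLE hle r) from hk)
        simpa [e, h1] using this
      have a2 : f j₂ r ≤ e i j₂ := by
        have := hmono j₂ (show (⟨k, (Nat.lt_succ_iff.1 k.2).trans_lt h2⟩ : Fin _) ≤ ⟨i, h2⟩ from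
          Nat.lt_succ_iff.1 k.2)
        simpa [e, h2, hr] using this
      have a3 : f j₁ (Fin.castLE hle r) < f j₂ r :=
        τ.row_lt _ _ _ hj ((hmem _ _).2 r.2)
      omega
    have hinj : Function.Injective (fun k : Fin (i + 1) => (⟨_, hlt k⟩ : Fin i)) := by
      intro a b hab
      simp only [Fin.mk.injEq] at hab
      have h := (s j₁).symm.injective (Fin.ext hab)
      have h' := (s j₂).injective (Fin.castLE_injective hle h)
      exact Fin.ext (by simpa using h')
    have := Fintype.card_le_of_injective _ hinj
    simp at this
  let T : InvertedTableau Y :=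
    { entry := e
      zeros := fun i j h => by
        rw [hmem] at h
        simp [e, h]
      pos := fun i j h => by
        rw [hmem] at h
        rw [he j ⟨i, h⟩]
        exact τ.pos _ _ ((hmem _ _).2 (Fin.is_lt _))
      no_skip := fun i j k h hk hle => by
        rw [hmem] at h
        rw [he j ⟨i, h⟩] at hle
        obtain ⟨i', j', h', hk'⟩ := τ.no_skip _ _ k ((hmem _ _).2 (Fin.is_lt _)) hk hle
        have h'' := (hmem _ _).1 h'
        refine ⟨(s j').symm ⟨i', h''⟩, j', (hmem _ _).2 (Fin.is_lt _), ?_⟩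
        rw [he j']
        simpa [f] using hk'
      row_lt := hrow }
  have hcol : ∀ (σ : InvertedTableau Y) j,
      σ.column j = Multiset.map (fun i : Fin (Y.colLen j) => σ.entry i j) Finset.univ.val := by
    intro σ j
    have : Multiset.range (Y.colLen j)
        = Multiset.map (fun i : Fin (Y.colLen j) => (i : ℕ)) Finset.univ.val := by
      rw [Fin.univ_val_map]
      simp [Multiset.range, List.ofFn_eq_map]
    rw [column, this, Multiset.map_map]
    rfl
  refine ⟨T, ⟨?_, ?_⟩, ?_⟩
  · intro i₁ i₂ j hi h
    have h2 := (hmem _ _).1 h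
    have := hmono j (show (⟨i₁, hi.trans h2⟩ : Fin _) ≤ ⟨i₂, h2⟩ from hi.le)
    simpa [T, e, h2, hi.trans h2] using this
  · intro j
    rw [hcol, hcol]
    have h1 : (fun i : Fin (Y.colLen j) => T.entry i j) = f j ∘ s j := by
      funext i
      exact he j i
    rw [h1, ← Multiset.map_map]
    congr 1
    have := congrArg Finset.val (Finset.map_univ_equiv (s j))
    simp
  · rintro T' ⟨hs, hc⟩
    have hT : ∀ j, T.column j = τ.column j := by
      intro j
      rw [hcol, hcol]
      have h1 : (fun i : Fin (Y.colLen j) => T.entry i j) = f j ∘ s j := by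
        funext i
        exact he j i
      rw [h1, ← Multiset.map_map]
      congr 1
      have := congrArg Finset.val (Finset.map_univ_equiv (s j))
      simp
    have key : ∀ i j, T'.entry i j = T.entry i j := by
      intro i j
      by_cases h : i < Y.colLen j
      · have hp : (List.ofFn fun i : Fin (Y.colLen j) => T'.entry i j).Perm
            (List.ofFn fun i : Fin (Y.colLen j) => T.entry i j) := by
          rw [← Multiset.coe_eq_coe, ← Fin.univ_val_map, ← Fin.univ_val_map, ← hcol, ← hcol,
            hc, hT]
        have m1 : Monotone fun i : Fin (Y.colLen j) => T'.entry i j := by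
          intro a b hab
          rcases hab.eq_or_lt with rfl | hab
          · exact le_rfl
          · exact hs _ _ _ hab ((hmem _ _).2 b.2)
        have m2 : Monotone fun i : Fin (Y.colLen j) => T.entry i j := by
          intro a b hab
          have := hmono j hab
          simpa [T, e] using this
        have := hp.eq_of_sortedLE m1.sortedLE_ofFn m2.sortedLE_ofFn
        exact congrFun (List.ofFn_injective this) ⟨i, h⟩
      · have h' : (i, j) ∉ Y := fun hh => h ((hmem _ _).1 hh)
        rw [T'.zeros _ _ h', T.zeros _ _ h']
    apply InvertedTableau.ext
    funext i j
    exact key i j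

/-- The standardization `st τ`: the unique semistandard Young tableau obtained by independently
reordering the columns of `τ`. -/
noncomputable def st (τ : InvertedTableau Y) : InvertedTableau Y :=
  τ.existsUnique_standardization.choose

theorem st_spec (τ : InvertedTableau Y) : τ.IsStandardization τ.st :=
  τ.existsUnique_standardization.choose_spec.1

/-- The set of inverted semistandard Young tableaux of shape `Y` and content `μ`
(that is, with exactly `μ k` boxes containing `k`). -/
def ofContent (Y : YoungDiagram) (μ : ℕ → ℕ) : Set (InvertedTableau Y) :=
  {τ | τ.content = μ}

/-- The set of inverted semistandard Young tableaux of shape `Y` and content `μ` with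
standardization `T`. -/
def withStandardization (Y : YoungDiagram) (μ : ℕ → ℕ) (T : InvertedTableau Y) :
    Set (InvertedTableau Y) :=
  {τ | τ ∈ ofContent Y μ ∧ τ.st = T}

/-- The entries in rows `r` and `s` of column `c` form (in this order) an inversion pair: the first
is smaller than the second, the `n` boxes to the right of either exist and have pairwise equal
entries, and then either one of the next two boxes does not exist and the smaller entry
appears below the larger one, or both exist and the one right of the smaller entry is larger. -/
def IsInversionPair (τ : InvertedTableau Y) (r s c : ℕ) : Prop :=
  (r, c) ∈ Y ∧ (s, c) ∈ Y ∧ τ.entry r c < τ.entry s c ∧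
  ∃ n : ℕ,
    (∀ k, 1 ≤ k → k ≤ n →
      (r, c + k) ∈ Y ∧ (s, c + k) ∈ Y ∧ τ.entry r (c + k) = τ.entry s (c + k)) ∧
    ((((r, c + n + 1) ∉ Y ∨ (s, c + n + 1) ∉ Y) ∧ s < r) ∨
      ((r, c + n + 1) ∈ Y ∧ (s, c + n + 1) ∈ Y ∧
        τ.entry s (c + n + 1) < τ.entry r (c + n + 1)))

open Classical in
/-- The number of inversion pairs, each pair of boxes being counted separately. -/
noncomputable def inv (τ : InvertedTableau Y) : ℕ :=
  ((Y.cells ×ˢ Y.cells).filter fun p =>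
    p.1.2 = p.2.2 ∧ τ.IsInversionPair p.1.1 p.2.1 p.1.2).card

/-- The height order on a column: `τ.HeightLT i₁ i₂ j` says that the entry in row `i₁` of column `j`
strictly precedes the entry in row `i₂` of column `j`. -/
inductive HeightLT (τ : InvertedTableau Y) : ℕ → ℕ → ℕ → Prop
  | above (i₁ i₂ j : ℕ) : (i₁, j) ∈ Y → (i₂, j) ∈ Y →
      ((i₁, j + 1) ∉ Y ∨ (i₂, j + 1) ∉ Y) → i₁ < i₂ → HeightLT τ i₁ i₂ j
  | right_lt (i₁ i₂ j : ℕ) : (i₁, j + 1) ∈ Y → (i₂, j + 1) ∈ Y →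
      τ.entry i₁ (j + 1) < τ.entry i₂ (j + 1) → HeightLT τ i₁ i₂ j
  | right_eq (i₁ i₂ j : ℕ) : (i₁, j + 1) ∈ Y → (i₂, j + 1) ∈ Y →
      τ.entry i₁ (j + 1) = τ.entry i₂ (j + 1) → HeightLT τ i₁ i₂ (j + 1) → HeightLT τ i₁ i₂ j

open Classical in
/-- The height of the entry in row `i` of column `j`: it is `k` if that entry is the `k`-th smallest
of its column in the height order. -/
noncomputable def height (τ : InvertedTableau Y) (i j : ℕ) : ℕ :=
  ((Finset.range (Y.colLen j)).filter fun i' => τ.HeightLT i' i j).card + 1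

/-- The array of entries after transposing rows `i₁` and `i₂` from column `j` leftward. -/
def partialRowTransposition (τ : InvertedTableau Y) (i₁ i₂ j : ℕ) : ℕ → ℕ → ℕ :=
  fun i k => if k ≤ j then τ.entry (Equiv.swap i₁ i₂ i) k else τ.entry i k

/-- The partial row transposition of `τ` at the entries in rows `i₁`, `i₂` of column `j` is defined
(the first entry is smaller than the second and their heights differ by one) and is admissible
(both entries are smaller than each of the entries directly to their right, where these exist). -/
def IsAdmissible (τ : InvertedTableau Y) (i₁ i₂ j : ℕ) : Prop :=
  (i₁, j) ∈ Y ∧ (i₂, j) ∈ Y ∧ τ.entry i₁ j < τ.entry i₂ j ∧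
  |(τ.height i₁ j : ℤ) - (τ.height i₂ j : ℤ)| = 1 ∧
  ((i₁, j + 1) ∈ Y → τ.entry i₁ j < τ.entry i₁ (j + 1) ∧ τ.entry i₂ j < τ.entry i₁ (j + 1)) ∧
  ((i₂, j + 1) ∈ Y → τ.entry i₁ j < τ.entry i₂ (j + 1) ∧ τ.entry i₂ j < τ.entry i₂ (j + 1))

/-- `τ'` is the result of an admissible transposition performed on `τ`. -/
def AdmissibleStep (τ τ' : InvertedTableau Y) : Prop :=
  ∃ i₁ i₂ j, τ.IsAdmissible i₁ i₂ j ∧ τ'.entry = τ.partialRowTransposition i₁ i₂ j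

/-- `τ` is obtained from `T` via a sequence of exactly `n` admissible transpositions. -/
def ObtainedIn (n : ℕ) (T τ : InvertedTableau Y) : Prop :=
  ∃ σ : ℕ → InvertedTableau Y, σ 0 = T ∧ σ n = τ ∧ ∀ m < n, AdmissibleStep (σ m) (σ (m + 1))

end InvertedTableau

namespace InvertedTableau

variable {Y : YoungDiagram}

/-! An inversion pair is a discordance between two orders on a column: the smaller entry comes later
in the height order (`isInversionPair_iff`). The height order on column `j` is a strict total order
determined by the columns to its right. An admissible transposition at column `j` therefore keeps
that order and exchanges two entries of consecutive height, while further left it permutes rows and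
order together. Exactly one discordance appears or disappears (`inv_of_heightLT`), so `inv` changes
by one per step, and it vanishes on `st τ`: this is the lower bound. Conversely, a discordance
forces one between consecutive heights, and the transposition there is automatically admissible
(`isAdmissible_of_adjacent_inversion`). Repeating it reaches `inv = 0`, which characterizes
semistandard tableaux. Columns keep their contents, so the endpoint is `st τ`; steps are reversible.
-/

/-! ### The height order as a strict total order -/

theorem heightLT_iff (τ : InvertedTableau Y) (x y j : ℕ) :
    τ.HeightLT x y j ↔ (x, j) ∈ Y ∧ (y, j) ∈ Y ∧
      ((((x, j + 1) ∉ Y ∨ (y, j + 1) ∉ Y) ∧ x < y) ∨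
        ((x, j + 1) ∈ Y ∧ (y, j + 1) ∈ Y ∧ (τ.entry x (j + 1) < τ.entry y (j + 1) ∨
          (τ.entry x (j + 1) = τ.entry y (j + 1) ∧ τ.HeightLT x y (j + 1))))) := by
  have hY : ∀ x, (x, j + 1) ∈ Y → (x, j) ∈ Y :=
    fun x h => Y.up_left_mem le_rfl (Nat.le_succ j) h
  constructor
  · rintro (⟨_, h1, h2, h3, h4⟩ | ⟨_, h1, h2, h3⟩ | ⟨_, h1, h2, h3, h4⟩)
    · exact ⟨h1, h2, Or.inl ⟨h3, h4⟩⟩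
    · exact ⟨hY _ h1, hY _ h2, Or.inr ⟨h1, h2, Or.inl h3⟩⟩
    · exact ⟨hY _ h1, hY _ h2, Or.inr ⟨h1, h2, Or.inr ⟨h3, h4⟩⟩⟩
  · rintro ⟨h1, h2, ⟨h3, h4⟩ | ⟨h3, h4, h5 | ⟨h5, h6⟩⟩⟩
    · exact .above _ _ _ h1 h2 h3 h4
    · exact .right_lt _ _ _ h3 h4 h5
    · exact .right_eq _ _ _ h3 h4 h5 h6

theorem HeightLT.mem_left {τ : InvertedTableau Y} {x y j : ℕ} (h : τ.HeightLT x y j) :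
    (x, j) ∈ Y := ((τ.heightLT_iff x y j).1 h).1

theorem HeightLT.mem_right {τ : InvertedTableau Y} {x y j : ℕ} (h : τ.HeightLT x y j) :
    (y, j) ∈ Y := ((τ.heightLT_iff x y j).1 h).2.1

/-- Induction on columns from right to left. -/
theorem column_induction (Y : YoungDiagram) {P : ℕ → Prop} (empty : ∀ j, (∀ i, (i, j) ∉ Y) → P j)
    (step : ∀ j, P (j + 1) → P j) (j : ℕ) : P j := by
  have h : ∀ d j, Y.rowLen 0 ≤ j + d → P j := by
    intro d
    induction d with
    | zero =>
      intro j hj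
      refine empty j fun i hi => ?_
      have := YoungDiagram.mem_iff_lt_rowLen.1 (Y.up_left_mem (Nat.zero_le i) le_rfl hi)
      omega
    | succ d ih => exact fun j hj => step j (ih (j + 1) (by omega))
  exact h _ j (Nat.le_add_left _ _)

theorem heightLT_irrefl (τ : InvertedTableau Y) (x j : ℕ) : ¬ τ.HeightLT x x j := by
  refine column_induction Y (P := fun j => ¬ τ.HeightLT x x j) ?_ ?_ j
  · exact fun j hj h => hj _ h.mem_left
  · intro j ih h
    rw [heightLT_iff] at h
    have := h.2.2
    simp_all

theorem mem_of_lt {x y j : ℕ} (h : x < y) (hy : (y, j) ∈ Y) : (x, j) ∈ Y :=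
  Y.up_left_mem h.le le_rfl hy

theorem HeightLT.trans {τ : InvertedTableau Y} {x y z j : ℕ} (h1 : τ.HeightLT x y j)
    (h2 : τ.HeightLT y z j) : τ.HeightLT x z j := by
  revert x y z
  refine column_induction Y (P := fun j => ∀ {x y z : ℕ}, τ.HeightLT x y j → τ.HeightLT y z j →
    τ.HeightLT x z j) ?_ ?_ j
  · exact fun j hj x y z h => absurd h.mem_left (hj _)
  · intro j ih x y z h1 h2
    rw [heightLT_iff] at h1 h2 ⊢
    have hm : ∀ {x y}, x < y → (y, j + 1) ∈ Y → (x, j + 1) ∈ Y := mem_of_lt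
    refine ⟨h1.1, h2.2.1, ?_⟩
    rcases h1.2.2 with ⟨a, a'⟩ | ⟨a, a', b⟩ <;> rcases h2.2.2 with ⟨c, c'⟩ | ⟨c, c', d⟩
    · left
      refine ⟨?_, a'.trans c'⟩
      by_contra! hc
      have := hm c' hc.2
      tauto
    -- In the mixed cases, rows with a box in column `j + 1` form an initial segment, so they lie
    -- above all the others.
    · exact absurd (hm a' c) (by tauto)
    · have hz : (z, j + 1) ∉ Y := by tauto
      refine Or.inl ⟨Or.inr hz, ?_⟩
      by_contra! hc
      rcases hc.eq_or_lt with rfl | hc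
      · exact hz a
      · exact hz (hm hc a)
    · right
      refine ⟨a, c', ?_⟩
      rcases b with b | ⟨b, b'⟩ <;> rcases d with d | ⟨d, d'⟩
      · left; omega
      · left; omega
      · left; omega
      · exact Or.inr ⟨b.trans d, ih b' d'⟩

theorem HeightLT.asymm {τ : InvertedTableau Y} {x y j : ℕ} (h1 : τ.HeightLT x y j) :
    ¬ τ.HeightLT y x j := fun h2 => τ.heightLT_irrefl _ _ (h1.trans h2)

theorem heightLT_total (τ : InvertedTableau Y) {x y j : ℕ} (hx : (x, j) ∈ Y) (hy : (y, j) ∈ Y)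
    (hne : x ≠ y) : τ.HeightLT x y j ∨ τ.HeightLT y x j := by
  revert x y
  refine column_induction Y (P := fun j => ∀ {x y : ℕ}, (x, j) ∈ Y → (y, j) ∈ Y → x ≠ y →
    τ.HeightLT x y j ∨ τ.HeightLT y x j) ?_ ?_ j
  · exact fun j hj x y h => absurd h (hj _)
  · intro j ih x y hx hy hne
    rw [heightLT_iff, heightLT_iff τ y x]
    by_cases h : (x, j + 1) ∈ Y ∧ (y, j + 1) ∈ Y
    · have := ih h.1 h.2 hne
      have := lt_trichotomy (τ.entry x (j + 1)) (τ.entry y (j + 1))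
      grind
    · have := lt_or_gt_of_ne hne
      tauto

/-- The number `n` of ties counts the uses of `right_eq`; alternatives (i) and (ii) are the two base
constructors, with the rows in reverse order. -/
theorem isInversionPair_iff (τ : InvertedTableau Y) (r s c : ℕ) :
    τ.IsInversionPair r s c ↔ τ.entry r c < τ.entry s c ∧ τ.HeightLT s r c := by
  constructor
  · rintro ⟨hr, hs, hlt, n, heq, hend⟩
    refine ⟨hlt, ?_⟩
    clear hlt
    induction n generalizing c with
    | zero =>
      rcases hend with ⟨h, h'⟩ | ⟨h, h', h''⟩
      · exact .above _ _ _ hs hr h.symm h'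
      · exact .right_lt _ _ _ h' h h''
    | succ n ih =>
      have h1 := heq 1 le_rfl (by omega)
      refine .right_eq _ _ _ h1.2.1 h1.1 h1.2.2.symm (ih (c + 1) h1.1 h1.2.1 ?_ ?_)
      · intro k hk hkn
        have := heq (k + 1) (by omega) (by omega)
        rwa [show c + 1 + k = c + (k + 1) by omega]
      · rwa [show c + 1 + n + 1 = c + (n + 1) + 1 by omega]
  · rintro ⟨hlt, h⟩
    refine ⟨h.mem_right, h.mem_left, hlt, ?_⟩
    clear hlt
    induction h with
    | above j hs hr h h' =>
      exact ⟨0, fun k h1 h2 => by omega, Or.inl ⟨h.symm, h'⟩⟩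
    | right_lt j hs hr h =>
      exact ⟨0, fun k h1 h2 => by omega, Or.inr ⟨hr, hs, h⟩⟩
    | right_eq j hs hr h _ ih =>
      obtain ⟨n, heq, hend⟩ := ih
      refine ⟨n + 1, fun k hk hkn => ?_, ?_⟩
      · rcases hk.eq_or_lt with rfl | hk
        · exact ⟨hr, hs, h.symm⟩
        · have := heq (k - 1) (by omega) (by omega)
          rwa [show j + 1 + (k - 1) = j + k by omega] at this
      · rwa [show j + 1 + n + 1 = j + (n + 1) + 1 by omega] at hend

/-! ### Heights -/

theorem height_lt_height {τ : InvertedTableau Y} {x y j : ℕ} (h : τ.HeightLT x y j) :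
    τ.height x j < τ.height y j := by
  classical
  unfold height
  refine Nat.succ_lt_succ (Finset.card_lt_card ?_)
  rw [Finset.ssubset_iff_of_subset]
  · exact ⟨x, by simpa [h] using YoungDiagram.mem_iff_lt_colLen.1 h.mem_left,
      by simp [heightLT_irrefl]⟩
  · intro z
    simp only [Finset.mem_filter]
    exact fun hz => ⟨hz.1, hz.2.trans h⟩

theorem height_eq_succ {τ : InvertedTableau Y} {x y j : ℕ} (h : τ.HeightLT x y j)
    (hadj : ∀ z, τ.HeightLT x z j → ¬ τ.HeightLT z y j) :
    τ.height y j = τ.height x j + 1 := by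
  classical
  have hx : x ∉ (Finset.range (Y.colLen j)).filter fun i' => τ.HeightLT i' x j := by
    simp [heightLT_irrefl]
  unfold height
  rw [← Finset.card_insert_of_notMem hx]
  congr 2
  ext z
  simp only [Finset.mem_filter, Finset.mem_insert, Finset.mem_range,
    ← YoungDiagram.mem_iff_lt_colLen]
  constructor
  · rintro ⟨hz, hzy⟩
    by_cases hne : z = x
    · exact Or.inl hne
    · rcases τ.heightLT_total hz h.mem_left hne with h' | h'
      · exact Or.inr ⟨hz, h'⟩
      · exact absurd hzy (hadj z h')
  · rintro (rfl | ⟨hz, hzx⟩)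
    · exact ⟨h.mem_left, h⟩
    · exact ⟨hz, hzx.trans h⟩

/-- Rows `x`, `y` of column `j` are comparable in the same way to every third row. -/
theorem heightLT_iff_of_height_adjacent {τ : InvertedTableau Y} {x y j : ℕ} (hx : (x, j) ∈ Y)
    (hy : (y, j) ∈ Y) (h : |(τ.height x j : ℤ) - (τ.height y j : ℤ)| = 1) {z : ℕ}
    (hzx : z ≠ x) (hzy : z ≠ y) :
    (τ.HeightLT x z j ↔ τ.HeightLT y z j) ∧ (τ.HeightLT z x j ↔ τ.HeightLT z y j) := by
  by_cases hz : (z, j) ∈ Y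
  · have hh : ∀ {a b}, τ.HeightLT a b j → τ.height a j < τ.height b j := height_lt_height
    have h1 := τ.heightLT_total hz hx hzx
    have h2 := τ.heightLT_total hz hy hzy
    rw [abs_eq one_pos.le] at h
    rcases h1 with h1 | h1 <;> rcases h2 with h2 | h2
    · simp [h1, h2, h1.asymm, h2.asymm]
    · have := hh h1
      have := hh h2
      omega
    · have := hh h1
      have := hh h2
      omega
    · simp [h1, h2, h1.asymm, h2.asymm]
  · have h1 : ∀ w, ¬ τ.HeightLT z w j := fun w h => hz h.mem_left
    have h2 : ∀ w, ¬ τ.HeightLT w z j := fun w h => hz h.mem_right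
    simp [h1, h2]

/-! ### Transpositions -/

theorem swap_mem_iff {i₁ i₂ j : ℕ} (h₁ : (i₁, j) ∈ Y) (h₂ : (i₂, j) ∈ Y) {k : ℕ} (hk : k ≤ j)
    (x : ℕ) : (Equiv.swap i₁ i₂ x, k) ∈ Y ↔ (x, k) ∈ Y := by
  have h₁' := Y.up_left_mem le_rfl hk h₁
  have h₂' := Y.up_left_mem le_rfl hk h₂
  by_cases hx1 : x = i₁
  · subst hx1; simp [h₁', h₂']
  by_cases hx2 : x = i₂
  · subst hx2; simp [h₁', h₂']
  rw [Equiv.swap_apply_of_ne_of_ne hx1 hx2]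

section Transposition

variable {τ τ' : InvertedTableau Y} {i₁ i₂ j : ℕ}

theorem entry_of_le (h : τ'.entry = τ.partialRowTransposition i₁ i₂ j) {k : ℕ} (hk : k ≤ j)
    (x : ℕ) : τ'.entry x k = τ.entry (Equiv.swap i₁ i₂ x) k := by
  simp [h, partialRowTransposition, hk]

theorem entry_of_lt (h : τ'.entry = τ.partialRowTransposition i₁ i₂ j) {k : ℕ} (hk : j < k)
    (x : ℕ) : τ'.entry x k = τ.entry x k := by
  simp [h, partialRowTransposition, hk]

/-- The order on column `c` reads only entries strictly to its right, so column `j` itself is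
included. -/
theorem heightLT_congr_right (h : τ'.entry = τ.partialRowTransposition i₁ i₂ j) {c : ℕ}
    (hc : j ≤ c) (x y : ℕ) : τ'.HeightLT x y c ↔ τ.HeightLT x y c := by
  revert hc
  refine column_induction Y (P := fun c => j ≤ c → (τ'.HeightLT x y c ↔ τ.HeightLT x y c)) ?_ ?_ c
  · exact fun c hc _ => ⟨fun h => absurd h.mem_left (hc _), fun h => absurd h.mem_left (hc _)⟩
  · intro c ih hc
    rw [heightLT_iff, heightLT_iff τ, entry_of_lt h (by omega), entry_of_lt h (by omega),
      ih (by omega)]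

theorem height_congr (h : τ'.entry = τ.partialRowTransposition i₁ i₂ j) (x : ℕ) :
    τ'.height x j = τ.height x j := by
  classical
  exact congrArg (fun s : Finset ℕ => s.card + 1)
    (Finset.filter_congr fun _ _ => heightLT_congr_right h le_rfl _ _)

/-- Consecutive elements of a total order compare alike with every third element. -/
theorem heightLT_swap_iff (hadm : τ.IsAdmissible i₁ i₂ j) {x y : ℕ}
    (h1 : ¬ (x = i₁ ∧ y = i₂)) (h2 : ¬ (x = i₂ ∧ y = i₁)) :
    τ.HeightLT (Equiv.swap i₁ i₂ x) (Equiv.swap i₁ i₂ y) j ↔ τ.HeightLT x y j := by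
  obtain ⟨m1, m2, -, hh, -⟩ := hadm
  have key := fun z => heightLT_iff_of_height_adjacent (z := z) m1 m2 hh
  have irr := fun z => τ.heightLT_irrefl z j
  simp only [Equiv.swap_apply_def]
  grind

/-- A row without a box in column `c` is fixed by the swap and lies below both swapped rows. -/
theorem swap_lt_swap_iff (m1 : (i₁, j) ∈ Y) (m2 : (i₂, j) ∈ Y) {c x y : ℕ} (hc : c ≤ j)
    (h : (x, c) ∉ Y ∨ (y, c) ∉ Y) :
    Equiv.swap i₁ i₂ x < Equiv.swap i₁ i₂ y ↔ x < y := by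
  have m1' := Y.up_left_mem le_rfl hc m1
  have m2' := Y.up_left_mem le_rfl hc m2
  have key : ∀ {a b}, (a, c) ∈ Y → (b, c) ∉ Y → a < b := by
    intro a b ha hb
    by_contra! hab
    exact hb (Y.up_left_mem hab le_rfl ha)
  simp only [Equiv.swap_apply_def]
  have := @key
  grind

/-- The only danger is at `c + 1 = j`, where the order does not follow the swap on the pair `i₁`,
`i₂`. Order in column `j` matters only for ties, and these two entries differ. -/
theorem heightLT_congr_left (hadm : τ.IsAdmissible i₁ i₂ j)
    (h : τ'.entry = τ.partialRowTransposition i₁ i₂ j) {c : ℕ} (hc : c < j) (x y : ℕ) :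
    τ'.HeightLT x y c ↔ τ.HeightLT (Equiv.swap i₁ i₂ x) (Equiv.swap i₁ i₂ y) c := by
  have m1 := hadm.1
  have m2 := hadm.2.1
  revert hc
  refine column_induction Y (P := fun c => c < j → (τ'.HeightLT x y c ↔
    τ.HeightLT (Equiv.swap i₁ i₂ x) (Equiv.swap i₁ i₂ y) c)) ?_ ?_ c
  · exact fun c hc _ => ⟨fun h => absurd h.mem_left (hc _), fun h => absurd h.mem_left (hc _)⟩
  · intro c ih hc
    have key : τ.entry (Equiv.swap i₁ i₂ x) (c + 1) = τ.entry (Equiv.swap i₁ i₂ y) (c + 1) →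
        (τ'.HeightLT x y (c + 1) ↔
          τ.HeightLT (Equiv.swap i₁ i₂ x) (Equiv.swap i₁ i₂ y) (c + 1)) := by
      intro he
      rcases (Nat.succ_le_of_lt hc).eq_or_lt with hc' | hc'
      · obtain rfl : c + 1 = j := hc'
        have hlt := hadm.2.2.1
        rw [heightLT_congr_right h le_rfl, heightLT_swap_iff hadm]
        · rintro ⟨rfl, rfl⟩
          simp only [Equiv.swap_apply_left, Equiv.swap_apply_right] at he
          omega
        · rintro ⟨rfl, rfl⟩
          simp only [Equiv.swap_apply_left, Equiv.swap_apply_right] at he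
          omega
      · exact ih hc'
    have key2 := swap_lt_swap_iff (x := x) (y := y) m1 m2 (Nat.succ_le_of_lt hc)
    rw [heightLT_iff, heightLT_iff τ, entry_of_le h (Nat.succ_le_of_lt hc),
      entry_of_le h (Nat.succ_le_of_lt hc), swap_mem_iff m1 m2 hc.le, swap_mem_iff m1 m2 hc.le,
      swap_mem_iff m1 m2 (Nat.succ_le_of_lt hc), swap_mem_iff m1 m2 (Nat.succ_le_of_lt hc)]
    exact and_congr Iff.rfl (and_congr Iff.rfl (or_congr
      (and_congr_right fun hm => (key2 hm).symm) (and_congr Iff.rfl (and_congr Iff.rfl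
        (or_congr Iff.rfl (and_congr_right key))))))

theorem IsAdmissible.symm (hadm : τ.IsAdmissible i₁ i₂ j)
    (h : τ'.entry = τ.partialRowTransposition i₁ i₂ j) : τ'.IsAdmissible i₂ i₁ j := by
  obtain ⟨m1, m2, hlt, hh, r1, r2⟩ := hadm
  simp only [IsAdmissible, height_congr h, entry_of_le h le_rfl, entry_of_lt h (Nat.lt_succ_self j),
    Equiv.swap_apply_left, Equiv.swap_apply_right]
  exact ⟨m2, m1, hlt, by rwa [abs_sub_comm], r2, r1⟩

theorem entry_eq_symm (h : τ'.entry = τ.partialRowTransposition i₁ i₂ j) :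
    τ.entry = τ'.partialRowTransposition i₂ i₁ j := by
  funext x k
  simp only [h, partialRowTransposition]
  split_ifs with hk
  · rw [Equiv.swap_comm i₂ i₁, Equiv.swap_apply_self]
  · rfl

theorem AdmissibleStep.symm (h : AdmissibleStep τ τ') : AdmissibleStep τ' τ := by
  obtain ⟨i₁, i₂, j, hadm, h⟩ := h
  exact ⟨i₂, i₁, j, hadm.symm h, entry_eq_symm h⟩

theorem column_eq_of_step (h : AdmissibleStep τ τ') (k : ℕ) : τ'.column k = τ.column k := by
  obtain ⟨i₁, i₂, j, ⟨m1, m2, -⟩, h⟩ := h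
  unfold column
  by_cases hk : k ≤ j
  · have hr : Multiset.range (Y.colLen k)
        = (Multiset.range (Y.colLen k)).map (Equiv.swap i₁ i₂) := by
      refine (Multiset.Nodup.ext (Multiset.nodup_range _)
        ((Multiset.nodup_range _).map (Equiv.swap i₁ i₂).injective)).2 fun x => ?_
      simp only [Multiset.mem_map, Multiset.mem_range, ← YoungDiagram.mem_iff_lt_colLen]
      constructor
      · exact fun hx => ⟨Equiv.swap i₁ i₂ x, (swap_mem_iff m1 m2 hk x).2 hx,
          Equiv.swap_apply_self _ _ _⟩
      · rintro ⟨y, hy, rfl⟩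
        exact (swap_mem_iff m1 m2 hk y).2 hy
    conv_rhs => rw [hr]
    rw [Multiset.map_map]
    exact Multiset.map_congr rfl fun x _ => entry_of_le h hk x
  · exact Multiset.map_congr rfl fun x _ => entry_of_lt h (not_le.1 hk) x

theorem st_eq_of_step (h : AdmissibleStep τ τ') : τ'.st = τ.st :=
  τ.existsUnique_standardization.unique
    ⟨τ'.st_spec.1, fun k => (τ'.st_spec.2 k).trans (column_eq_of_step h k)⟩ τ.st_spec

/-! ### The effect of a step on the number of inversions -/

open Classical in
/-- The pairs of boxes forming an inversion pair. -/
noncomputable def inversions (τ : InvertedTableau Y) : Finset ((ℕ × ℕ) × (ℕ × ℕ)) :=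
  (Y.cells ×ˢ Y.cells).filter fun p => p.1.2 = p.2.2 ∧ τ.IsInversionPair p.1.1 p.2.1 p.1.2

theorem mem_inversions {r c s d : ℕ} : ((r, c), (s, d)) ∈ τ.inversions ↔
    c = d ∧ τ.entry r c < τ.entry s c ∧ τ.HeightLT s r c := by
  classical
  simp only [inversions, Finset.mem_filter, Finset.mem_product, YoungDiagram.mem_cells,
    isInversionPair_iff]
  constructor
  · exact fun h => h.2
  · rintro ⟨rfl, h1, h2⟩
    exact ⟨⟨h2.mem_right, h2.mem_left⟩, rfl, h1, h2⟩

/-- The permutation of the boxes effected by a partial row transposition. -/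
def boxSwap (i₁ i₂ j : ℕ) (p : ℕ × ℕ) : ℕ × ℕ :=
  if p.2 ≤ j then (Equiv.swap i₁ i₂ p.1, p.2) else p

theorem boxSwap_boxSwap (i₁ i₂ j : ℕ) (p : ℕ × ℕ) :
    boxSwap i₁ i₂ j (boxSwap i₁ i₂ j p) = p := by
  unfold boxSwap
  split_ifs <;> simp_all

theorem boxSwap_mem_inversions (hadm : τ.IsAdmissible i₁ i₂ j)
    (h : τ'.entry = τ.partialRowTransposition i₁ i₂ j) {p : (ℕ × ℕ) × (ℕ × ℕ)}
    (h1 : p ≠ ((i₁, j), (i₂, j))) (h2 : p ≠ ((i₂, j), (i₁, j))) :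
    (boxSwap i₁ i₂ j p.1, boxSwap i₁ i₂ j p.2) ∈ τ.inversions ↔ p ∈ τ'.inversions := by
  obtain ⟨⟨r, c⟩, ⟨s, d⟩⟩ := p
  by_cases hcd : c = d
  · subst hcd
    simp only [boxSwap]
    split_ifs with hc
    · rw [mem_inversions, mem_inversions, entry_of_le h hc, entry_of_le h hc]
      simp only [true_and]
      rcases hc.eq_or_lt with rfl | hc
      · rw [heightLT_congr_right h le_rfl, heightLT_swap_iff hadm]
        · rintro ⟨rfl, rfl⟩; exact h2 rfl
        · rintro ⟨rfl, rfl⟩; exact h1 rfl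
      · rw [heightLT_congr_left hadm h hc]
    · rw [mem_inversions, mem_inversions, entry_of_lt h (not_le.1 hc), entry_of_lt h (not_le.1 hc),
        heightLT_congr_right h (not_le.1 hc).le]
  · have e1 : ∀ p, (boxSwap i₁ i₂ j p).2 = p.2 := by
      intro p; unfold boxSwap; split_ifs <;> rfl
    constructor
    · intro hm
      have := (mem_inversions (r := (boxSwap i₁ i₂ j (r, c)).1) (c := (boxSwap i₁ i₂ j (r, c)).2)
        (s := (boxSwap i₁ i₂ j (s, d)).1) (d := (boxSwap i₁ i₂ j (s, d)).2)).1 hm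
      rw [e1, e1] at this
      exact absurd this.1 hcd
    · exact fun hm => absurd (mem_inversions.1 hm).1 hcd

/-- A transposition which interchanges an entry with a larger one of smaller height decreases the
number of inversion pairs by one. -/
theorem inv_of_heightLT (hadm : τ.IsAdmissible i₁ i₂ j)
    (h : τ'.entry = τ.partialRowTransposition i₁ i₂ j) (hH : τ.HeightLT i₂ i₁ j) :
    τ.inv = τ'.inv + 1 := by
  classical
  have hlt := hadm.2.2.1
  -- Of the two exceptional ordered pairs, in either tableau, only `((i₁, j), (i₂, j))` in `τ` is an
  -- inversion; `φ` matches all the rest.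
  have n1 : ((i₂, j), (i₁, j)) ∉ τ.inversions := fun hm => by
    have := (mem_inversions.1 hm).2.1; omega
  have n2 : ((i₁, j), (i₂, j)) ∉ τ'.inversions := fun hm => by
    have := (mem_inversions.1 hm).2.1
    rw [entry_of_le h le_rfl, entry_of_le h le_rfl] at this
    simp only [Equiv.swap_apply_left, Equiv.swap_apply_right] at this
    omega
  have n3 : ((i₂, j), (i₁, j)) ∉ τ'.inversions := fun hm => by
    have := (mem_inversions.1 hm).2.2
    rw [heightLT_congr_right h le_rfl] at this
    exact this.asymm hH
  have y : ((i₁, j), (i₂, j)) ∈ τ.inversions := mem_inversions.2 ⟨rfl, hlt, hH⟩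
  change τ.inversions.card = τ'.inversions.card + 1
  rw [← Finset.card_erase_add_one y]
  congr 1
  have b1 : boxSwap i₁ i₂ j (i₁, j) = (i₂, j) := by simp [boxSwap]
  have b2 : boxSwap i₁ i₂ j (i₂, j) = (i₁, j) := by simp [boxSwap]
  have bb := boxSwap_boxSwap i₁ i₂ j
  let φ : (ℕ × ℕ) × (ℕ × ℕ) → (ℕ × ℕ) × (ℕ × ℕ) :=
    fun p => (boxSwap i₁ i₂ j p.1, boxSwap i₁ i₂ j p.2)
  have hφ : ∀ p, φ (φ p) = p := fun p => by simp [φ, bb]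
  have φ1 : φ ((i₁, j), (i₂, j)) = ((i₂, j), (i₁, j)) := by simp [φ, b1, b2]
  have φ2 : φ ((i₂, j), (i₁, j)) = ((i₁, j), (i₂, j)) := by simp [φ, b1, b2]
  refine Finset.card_bij' (fun p _ => φ p) (fun p _ => φ p) ?_ ?_ (fun p _ => hφ p)
    (fun p _ => hφ p)
  · intro p hp
    rw [Finset.mem_erase] at hp
    refine (boxSwap_mem_inversions hadm h ?_ ?_).1 (show φ (φ p) ∈ _ by rw [hφ]; exact hp.2)
    · intro he
      rw [← hφ p, he, φ1] at hp
      exact n1 hp.2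
    · intro he
      rw [← hφ p, he, φ2] at hp
      exact hp.1 rfl
  · intro p hp
    have p1 : p ≠ ((i₁, j), (i₂, j)) := fun he => n2 (he ▸ hp)
    have p2 : p ≠ ((i₂, j), (i₁, j)) := fun he => n3 (he ▸ hp)
    rw [Finset.mem_erase]
    refine ⟨fun he => p2 ?_, (boxSwap_mem_inversions hadm h p1 p2).2 hp⟩
    rw [← hφ p, he, φ1]

theorem inv_le_of_step (hs : AdmissibleStep τ τ') : τ'.inv ≤ τ.inv + 1 := by
  obtain ⟨i₁, i₂, j, hadm, h⟩ := hs
  have hne : i₁ ≠ i₂ := by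
    rintro rfl
    exact lt_irrefl _ hadm.2.2.1
  rcases τ.heightLT_total hadm.1 hadm.2.1 hne with hH | hH
  -- Here the reverse step removes an inversion.
  · exact (inv_of_heightLT (hadm.symm h) (entry_eq_symm h) ((heightLT_congr_right h le_rfl _ _).2 hH)).le
  · have := inv_of_heightLT hadm h hH
    omega

end Transposition

/-! ### Removing inversions -/

/-- The inverted tableau resulting from an admissible transposition. -/
def transpose (τ : InvertedTableau Y) {i₁ i₂ j : ℕ} (hadm : τ.IsAdmissible i₁ i₂ j) :
    InvertedTableau Y where
  entry := τ.partialRowTransposition i₁ i₂ j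
  zeros i k h := by
    unfold partialRowTransposition
    split_ifs with hk
    · exact τ.zeros _ _ fun h' => h ((swap_mem_iff hadm.1 hadm.2.1 hk i).1 h')
    · exact τ.zeros _ _ h
  pos i k h := by
    unfold partialRowTransposition
    split_ifs with hk
    · exact τ.pos _ _ ((swap_mem_iff hadm.1 hadm.2.1 hk i).2 h)
    · exact τ.pos _ _ h
  no_skip i k m h hm hle := by
    have hex : ∃ i' j', (i', j') ∈ Y ∧ τ.entry i' j' = m := by
      unfold partialRowTransposition at hle
      split_ifs at hle with hk
      · exact τ.no_skip _ _ m ((swap_mem_iff hadm.1 hadm.2.1 hk i).2 h) hm hle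
      · exact τ.no_skip _ _ m h hm hle
    obtain ⟨i', j', h', he⟩ := hex
    by_cases hj : j' ≤ j
    · exact ⟨Equiv.swap i₁ i₂ i', j', (swap_mem_iff hadm.1 hadm.2.1 hj i').2 h', by
        simp [partialRowTransposition, hj, he]⟩
    · exact ⟨i', j', h', by simp [partialRowTransposition, hj, he]⟩
  row_lt i c d hcd h := by
    obtain ⟨m1, m2, hlt, -, r1, r2⟩ := hadm
    unfold partialRowTransposition
    by_cases hd : d ≤ j
    · rw [if_pos (by omega), if_pos hd]
      exact τ.row_lt _ _ _ hcd ((swap_mem_iff m1 m2 hd i).2 h)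
    · rw [if_neg hd]
      split_ifs with hc
      -- Only comparisons across the boundary `c ≤ j < d` need admissibility, and they reduce to
      -- columns `j` and `j + 1`.
      · have hij : (i, j + 1) ∈ Y := Y.up_left_mem le_rfl (by omega) h
        have e1 : τ.entry i (j + 1) ≤ τ.entry i d := by
          rcases (show j + 1 ≤ d by omega).eq_or_lt with rfl | hlt
          · exact le_rfl
          · exact (τ.row_lt _ _ _ hlt h).le
        have e2 : τ.entry (Equiv.swap i₁ i₂ i) c ≤ τ.entry (Equiv.swap i₁ i₂ i) j := by
          rcases hc.eq_or_lt with rfl | hlt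
          · exact le_rfl
          · exact (τ.row_lt _ _ _ hlt ((swap_mem_iff m1 m2 le_rfl i).2
              (Y.up_left_mem le_rfl (Nat.le_succ j) hij))).le
        refine e2.trans_lt (lt_of_lt_of_le ?_ e1)
        by_cases hi1 : i = i₁
        · subst hi1
          simpa using (r1 hij).2
        by_cases hi2 : i = i₂
        · subst hi2
          simpa using (r2 hij).1
        rw [Equiv.swap_apply_of_ne_of_ne hi1 hi2]
        exact τ.row_lt _ _ _ (Nat.lt_succ_self j) hij
      · exact τ.row_lt _ _ _ hcd h

/-- If there is an inversion pair, then there is one of adjacent heights. -/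
theorem exists_adjacent_inversion (τ : InvertedTableau Y) {r s j : ℕ}
    (h : τ.entry r j < τ.entry s j) (hH : τ.HeightLT s r j) :
    ∃ r s, τ.entry r j < τ.entry s j ∧ τ.HeightLT s r j ∧
      ∀ z, τ.HeightLT s z j → ¬ τ.HeightLT z r j := by
  induction hd : τ.height r j - τ.height s j using Nat.strong_induction_on generalizing r s with
  | _ d ih =>
  by_cases hz : ∃ z, τ.HeightLT s z j ∧ τ.HeightLT z r j
  · obtain ⟨z, h1, h2⟩ := hz
    have h1' := height_lt_height h1
    have h2' := height_lt_height h2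
    -- A row `z` of intermediate height forms an inversion with `s` or with `r`, of smaller height
    -- difference.
    rcases lt_or_ge (τ.entry z j) (τ.entry s j) with he | he
    · exact ih _ (by omega) he h1 rfl
    · exact ih _ (by omega) (h.trans_le he) h2 rfl
  · push Not at hz
    exact ⟨r, s, h, hH, hz⟩

/-- Since `s` precedes `r`, a right neighbour of `r` is at least that of `s`, which exists and
exceeds the larger entry of the pair. -/
theorem isAdmissible_of_adjacent_inversion (τ : InvertedTableau Y) {r s j : ℕ}
    (h : τ.entry r j < τ.entry s j) (hH : τ.HeightLT s r j)
    (hz : ∀ z, τ.HeightLT s z j → ¬ τ.HeightLT z r j) : τ.IsAdmissible r s j := by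
  have key : (r, j + 1) ∈ Y → (s, j + 1) ∈ Y ∧ τ.entry s (j + 1) ≤ τ.entry r (j + 1) := by
    intro hr
    rcases ((heightLT_iff _ _ _ _).1 hH).2.2 with ⟨h1, h2⟩ | ⟨h1, -, h2⟩
    · exact absurd (mem_of_lt h2 hr) (by tauto)
    · exact ⟨h1, by omega⟩
  have hs : (s, j + 1) ∈ Y → τ.entry s j < τ.entry s (j + 1) :=
    τ.row_lt s _ _ (Nat.lt_succ_self j)
  refine ⟨hH.mem_right, hH.mem_left, h, ?_, fun hr => ?_, fun hs' => ?_⟩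
  · rw [height_eq_succ hH hz]
    simp
  · have h1 := key hr
    have h2 := hs h1.1
    omega
  · have h2 := hs hs'
    omega

/-- In a column-semistandard tableau the height order is the order from top to bottom. -/
theorem heightLT_of_lt {τ : InvertedTableau Y} (hτ : τ.ColumnSemistandard) {x y j : ℕ}
    (hxy : x < y) (hy : (y, j) ∈ Y) : τ.HeightLT x y j := by
  revert hy
  refine column_induction Y (P := fun j => (y, j) ∈ Y → τ.HeightLT x y j) ?_ ?_ j
  · exact fun j hj h => absurd h (hj _)
  · intro j ih hy
    by_cases hy' : (y, j + 1) ∈ Y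
    · rcases (hτ x y (j + 1) hxy hy').eq_or_lt with he | he
      · exact .right_eq _ _ _ (mem_of_lt hxy hy') hy' he (ih hy')
      · exact .right_lt _ _ _ (mem_of_lt hxy hy') hy' he
    · exact .above _ _ _ (mem_of_lt hxy hy) hy (Or.inr hy') hxy

theorem inversions_eq_empty {τ : InvertedTableau Y} (hτ : τ.ColumnSemistandard) :
    τ.inversions = ∅ := by
  rw [Finset.eq_empty_iff_forall_notMem]
  rintro ⟨⟨r, c⟩, ⟨s, d⟩⟩ hm
  obtain ⟨-, hlt, hH⟩ := mem_inversions.1 hm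
  rcases lt_trichotomy r s with h | rfl | h
  · exact (heightLT_of_lt hτ h hH.mem_left).asymm hH
  · exact lt_irrefl _ hlt
  · have := hτ s r c h hH.mem_right
    omega

/-- Weakly increasing columns on the right make the height order top-to-bottom; without discordances
the present column then increases weakly too. Both facts must be carried through the induction. -/
theorem columnSemistandard_of_inversions_eq_empty {τ : InvertedTableau Y}
    (hτ : τ.inversions = ∅) : τ.ColumnSemistandard := by
  have key : ∀ j i₁ i₂, i₁ < i₂ → (i₂, j) ∈ Y →
      τ.HeightLT i₁ i₂ j ∧ τ.entry i₁ j ≤ τ.entry i₂ j := by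
    intro j
    refine column_induction Y (P := fun j => ∀ i₁ i₂, i₁ < i₂ → (i₂, j) ∈ Y →
      τ.HeightLT i₁ i₂ j ∧ τ.entry i₁ j ≤ τ.entry i₂ j) ?_ ?_ j
    · exact fun j hj _ _ _ h => absurd h (hj _)
    · intro j ih x y hxy hy
      have hH : τ.HeightLT x y j := by
        by_cases hy' : (y, j + 1) ∈ Y
        · obtain ⟨h1, h2⟩ := ih x y hxy hy'
          rcases h2.eq_or_lt with he | he
          · exact .right_eq _ _ _ (mem_of_lt hxy hy') hy' he h1
          · exact .right_lt _ _ _ (mem_of_lt hxy hy') hy' he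
        · exact .above _ _ _ (mem_of_lt hxy hy) hy (Or.inr hy') hxy
      refine ⟨hH, ?_⟩
      by_contra! hlt
      have := mem_inversions.2 ⟨rfl, hlt, hH⟩
      simp [hτ] at this
  exact fun i₁ i₂ j h hm => (key j i₁ i₂ h hm).2

/-! ### Sequences of steps and minimality -/

theorem ObtainedIn.step {n : ℕ} {T τ τ' : InvertedTableau Y} (h : ObtainedIn n T τ)
    (hs : AdmissibleStep τ τ') : ObtainedIn (n + 1) T τ' := by
  obtain ⟨σ, h0, hn, hσ⟩ := h
  refine ⟨fun m => if m ≤ n then σ m else τ', by simp [h0], by simp, fun m hm => ?_⟩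
  rcases (Nat.lt_succ_iff.1 hm).eq_or_lt with rfl | hm
  · simpa [hn] using hs
  · simpa [hm.le, Nat.succ_le_of_lt hm] using hσ m hm

theorem ObtainedIn.inv_le {n : ℕ} {T τ : InvertedTableau Y} (h : ObtainedIn n T τ) :
    τ.inv ≤ T.inv + n := by
  obtain ⟨σ, rfl, rfl, hσ⟩ := h
  have : ∀ m ≤ n, (σ m).inv ≤ (σ 0).inv + m := by
    intro m
    induction m with
    | zero => simp
    | succ m ih =>
      intro hm
      have h1 := ih (by omega)
      have h2 := inv_le_of_step (hσ m (by omega))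
      omega
  exact this n le_rfl

theorem obtainedIn_inv (τ : InvertedTableau Y) : ObtainedIn τ.inv τ.st τ := by
  induction hn : τ.inv generalizing τ with
  | zero =>
    have hs := columnSemistandard_of_inversions_eq_empty (Finset.card_eq_zero.1 hn)
    have : τ.st = τ :=
      τ.existsUnique_standardization.unique τ.st_spec ⟨hs, fun _ => rfl⟩
    exact ⟨fun _ => τ, this.symm, rfl, fun m hm => by omega⟩
  | succ n ih =>
    obtain ⟨⟨⟨r, c⟩, ⟨s, d⟩⟩, hm⟩ : τ.inversions.Nonempty := by
      rw [← Finset.card_pos]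
      exact (Nat.succ_pos n).trans_eq hn.symm
    obtain ⟨-, hlt, hH⟩ := mem_inversions.1 hm
    obtain ⟨r, s, hlt, hH, hz⟩ := τ.exists_adjacent_inversion hlt hH
    have hadm := τ.isAdmissible_of_adjacent_inversion hlt hH hz
    have hstep : AdmissibleStep τ (τ.transpose hadm) := ⟨r, s, c, hadm, rfl⟩
    have hinv := inv_of_heightLT (τ' := τ.transpose hadm) hadm rfl hH
    have h := ih (τ.transpose hadm) (by omega)
    rw [st_eq_of_step hstep] at h
    -- The step removing an inversion, reversed, becomes the last step from `τ.st` to `τ`.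
    exact h.step hstep.symm

end InvertedTableau

theorem mainTheorem3 (Y : YoungDiagram) (μ : ℕ → ℕ) (T τ : InvertedTableau Y)
    (hτ : τ ∈ InvertedTableau.withStandardization Y μ T) :
    (∃ n : ℕ, InvertedTableau.ObtainedIn n T τ) ∧
      IsLeast {n : ℕ | InvertedTableau.ObtainedIn n T τ} τ.inv := by
  obtain ⟨-, rfl⟩ := hτ
  have h0 : τ.st.inv = 0 :=
    Finset.card_eq_zero.2 (InvertedTableau.inversions_eq_empty τ.st_spec.1)
  refine ⟨⟨_, τ.obtainedIn_inv⟩, τ.obtainedIn_inv, fun n hn => ?_⟩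
  have := InvertedTableau.ObtainedIn.inv_le hn
  omega
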